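/- For complex $a,q$ with $|q|<1$ put $(a;q)_n=\prod_{j=0}^{n-1}(1-aq^j)$ for $n\ge0$, $(a;q)_\infty=\prod_{j\ge0}(1-aq^j)$ and $(a_1,\dots,a_k;q)_\infty=(a_1;q)_\infty\cdots(a_k;q)_\infty$. Let $$\binom{N}{n}_q=\frac{(q;q)_N}{(q;q)_n(q;q)_{N-n}}\quad(0\le n\le N),\qquad \binom Nn_q=0\ \text{ otherwise.}$$ Then for every complex $q$ with $|q|<1$ all the series below converge absolutely (terms with vanishing $q$-binomial coefficient being $0$), and $$\sum_{a,b\ge0}\frac{q^{2(a^2-3ab+3b^2)}}{(q^3;q^3)_{2b}}\binom{3b}{2a}_q=(-q^2,-q^4;q^6)_\infty\sum_{c\ge0}\frac{q^{3c}}{(q^3;q^3)_{2c}}$$ $$=\frac1{(q^2,q^{10};q^{12})_\infty\,(q^{3},q^{6},q^{9},q^{9},q^{12},q^{15},q^{15},q^{21},q^{27},q^{33},q^{33},q^{36},q^{39},q^{39},q^{42},q^{45};q^{48})_\infty},$$ and $$\sum_{a,b\ge0}\frac{q^{2(a^2-3ab+3b^2)+2a-3b-1}}{(q^3;q^3)_{2b}}\binom{3b}{2a+1}_q=(-q^2,-q^4;q^6)_\infty\sum_{c\ge0}\frac{q^{3c}}{(q^3;q^3)_{2c+1}}$$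 $$=\frac1{(q^2,q^{10};q^{12})_\infty\,(q^{3},q^{3},q^{9},q^{12},q^{15},q^{18},q^{21},q^{21},q^{27},q^{27},q^{30},q^{33},q^{36},q^{39},q^{45},q^{45};q^{48})_\infty}.$$ -/

import Mathlib

/-- The finite `q`-shifted factorial `(a; q)_n = ∏_{j=0}^{n-1} (1 - a q^j)`. -/
noncomputable def qPoch (a q : ℂ) (n : ℕ) : ℂ :=
  ∏ j ∈ Finset.range n, (1 - a * q ^ j)

/-- The infinite `q`-shifted factorial `(a; q)_∞ = ∏_{j ≥ 0} (1 - a q^j)`.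
For `‖q‖ < 1` the product converges, see `multipliable_qPochInf`. -/
noncomputable def qPochInf (a q : ℂ) : ℂ :=
  ∏' j : ℕ, (1 - a * q ^ j)

/-- The compressed notation `(a₁, …, a_k; q)_∞ = (a₁; q)_∞ ⋯ (a_k; q)_∞`. -/
noncomputable def qPochInfList (as : List ℂ) (q : ℂ) : ℂ :=
  (as.map fun a => qPochInf a q).prod

/-- The `q`-binomial coefficient: `(q;q)_N / ((q;q)_n (q;q)_{N-n})` for `0 ≤ n ≤ N`,
and `0` otherwise. -/
noncomputable def qBinom (N n : ℕ) (q : ℂ) : ℂ :=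
  if n ≤ N then qPoch q q N / (qPoch q q n * qPoch q q (N - n)) else 0

theorem summable_norm_qPochInf {q : ℂ} (hq : ‖q‖ < 1) (a : ℂ) :
    Summable fun j : ℕ => ‖-(a * q ^ j)‖ := by
  simpa [norm_mul, norm_pow] using
    (summable_geometric_of_lt_one (norm_nonneg q) hq).mul_left ‖a‖

/-- The infinite product defining `(a; q)_∞` converges when `‖q‖ < 1`. -/
theorem multipliable_qPochInf {q : ℂ} (hq : ‖q‖ < 1) (a : ℂ) :
    Multipliable fun j : ℕ => 1 - a * q ^ j := by
  simpa [sub_eq_add_neg] using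
    multipliable_one_add_of_summable (summable_norm_qPochInf hq a)

theorem one_sub_mul_pow_ne_zero {a q : ℂ} (hq : ‖q‖ < 1) (ha : ‖a‖ < 1) (j : ℕ) :
    1 - a * q ^ j ≠ 0 := by
  intro h
  have h1 : ‖a * q ^ j‖ = 1 := by rw [← sub_eq_zero.mp h, norm_one]
  have h2 : ‖a * q ^ j‖ ≤ ‖a‖ := by
    rw [norm_mul, norm_pow]
    exact mul_le_of_le_one_right (norm_nonneg a) (pow_le_one₀ (norm_nonneg q) hq.le)
  linarith

/-- `(a; q)_n` does not vanish when `‖q‖ < 1` and `‖a‖ < 1`. -/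
theorem qPoch_ne_zero {a q : ℂ} (hq : ‖q‖ < 1) (ha : ‖a‖ < 1) (n : ℕ) :
    qPoch a q n ≠ 0 :=
  Finset.prod_ne_zero_iff.mpr fun j _ => one_sub_mul_pow_ne_zero hq ha j

/-- `(a; q)_∞` does not vanish when `‖q‖ < 1` and `‖a‖ < 1`. -/
theorem qPochInf_ne_zero {a q : ℂ} (hq : ‖q‖ < 1) (ha : ‖a‖ < 1) :
    qPochInf a q ≠ 0 := by
  have h := tprod_one_add_ne_zero_of_summable (f := fun j : ℕ => -(a * q ^ j))
    (fun j => by simpa [sub_eq_add_neg] using one_sub_mul_pow_ne_zero hq ha j)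
    (summable_norm_qPochInf hq a)
  simpa [qPochInf, sub_eq_add_neg] using h

/-! Write `q = y ^ 2`. Completing the square merges the two double series into one, `cubicTerm`,
with exponent `(r - 3b)^2 + 3b^2` in `y`: the indices `r = 2a` give the first series and `r = 2a +
1` give `y ^ 3` times the second. For fixed `b` the sum over `r` is a finite q-binomial theorem with
value `(-y; y^2)_{3b}`. Trisecting this product and cancelling `(-y^3; y^6)_b` against `(y^6;
y^6)_{2b}` leaves a q-Bailey summand in base `y^6`, so `tsum_qBaileyTerm` evaluates the whole sum as
`(-y^4, -y^8; y^12)_∞ / (y^3; y^6)_∞`.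

With `x = y ^ 3`, Euler's expansion of `1 / (x; x^2)_∞` splits by parity into the two single series.
The same quotient is `1 / (x^2; x^2)_∞` times the theta series `∑ x^(2k^2 - k)`, whose even and odd
`k` are again theta products by `tsum_jacobi`. In each case the two halves are even and odd in the
variable, so comparing it with its negative yields both identities at once. The modulus 48 products
then follow by splitting residue classes.

The square root argument divides by `y`, so `q = 0` is checked directly. -/

open Filter Topology

/-! ### Finite and infinite q-shifted factorials. -/

theorem qPoch_zero (a q : ℂ) : qPoch a q 0 = 1 := by simp [qPoch]

theorem qPoch_succ (a q : ℂ) (n : ℕ) : qPoch a q (n + 1) = qPoch a q n * (1 - a * q ^ n) := by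
  simp [qPoch, Finset.prod_range_succ]

theorem qPoch_succ' (a q : ℂ) (n : ℕ) : qPoch a q (n + 1) = (1 - a) * qPoch (a * q) q n := by
  simp only [qPoch, Finset.prod_range_succ', pow_zero, mul_one]
  rw [mul_comm]
  congr 1
  exact Finset.prod_congr rfl fun j _ => by ring

theorem qPoch_add (a q : ℂ) (m n : ℕ) :
    qPoch a q (m + n) = qPoch a q m * qPoch (a * q ^ m) q n := by
  simp only [qPoch, Finset.prod_range_add]
  congr 1
  exact Finset.prod_congr rfl fun j _ => by ring

theorem qPoch_mul_neg (a q : ℂ) (n : ℕ) :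
    qPoch a q n * qPoch (-a) q n = qPoch (a ^ 2) (q ^ 2) n := by
  simp only [qPoch, ← Finset.prod_mul_distrib]
  exact Finset.prod_congr rfl fun j _ => by ring

theorem qPoch_two_mul (a q : ℂ) (n : ℕ) :
    qPoch a q (2 * n) = qPoch a (q ^ 2) n * qPoch (a * q) (q ^ 2) n := by
  induction n with
  | zero => simp [qPoch_zero]
  | succ n ih =>
    rw [show 2 * (n + 1) = 2 * n + 1 + 1 by ring, qPoch_succ, qPoch_succ, ih, qPoch_succ,
      qPoch_succ]
    ring

theorem qPoch_three_mul (a q : ℂ) (n : ℕ) :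
    qPoch a q (3 * n) =
      qPoch a (q ^ 3) n * qPoch (a * q) (q ^ 3) n * qPoch (a * q ^ 2) (q ^ 3) n := by
  induction n with
  | zero => simp [qPoch_zero]
  | succ n ih =>
    rw [show 3 * (n + 1) = 3 * n + 1 + 1 + 1 by ring, qPoch_succ, qPoch_succ, qPoch_succ, ih,
      qPoch_succ, qPoch_succ, qPoch_succ]
    ring

theorem tendsto_qPoch {q : ℂ} (hq : ‖q‖ < 1) (a : ℂ) :
    Tendsto (qPoch a q) atTop (𝓝 (qPochInf a q)) :=
  (multipliable_qPochInf hq a).tendsto_prod_tprod_nat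

theorem exists_norm_qPoch_le {q : ℂ} (hq : ‖q‖ < 1) (a : ℂ) :
    ∃ C : ℝ, 0 < C ∧ ∀ n, ‖qPoch a q n‖ ≤ C := by
  obtain ⟨C, hC⟩ := (Metric.isBounded_range_of_tendsto _ (tendsto_qPoch hq a)).exists_norm_le
  exact ⟨max C 1, by positivity, fun n => (hC _ ⟨n, rfl⟩).trans (le_max_left _ _)⟩

theorem exists_norm_inv_qPoch_le {a q : ℂ} (hq : ‖q‖ < 1) (ha : ‖a‖ < 1) :
    ∃ C : ℝ, 0 < C ∧ ∀ n, ‖(qPoch a q n)⁻¹‖ ≤ C := by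
  obtain ⟨C, hC⟩ := (Metric.isBounded_range_of_tendsto _
    ((tendsto_qPoch hq a).inv₀ (qPochInf_ne_zero hq ha))).exists_norm_le
  exact ⟨max C 1, by positivity, fun n => (hC _ ⟨n, rfl⟩).trans (le_max_left _ _)⟩

theorem norm_pow_lt_one {q : ℂ} (hq : ‖q‖ < 1) {n : ℕ} (hn : n ≠ 0) : ‖q ^ n‖ < 1 := by
  rw [norm_pow]
  exact pow_lt_one₀ (norm_nonneg q) hq hn

theorem qPochInf_mul_neg {q : ℂ} (hq : ‖q‖ < 1) (a : ℂ) :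
    qPochInf a q * qPochInf (-a) q = qPochInf (a ^ 2) (q ^ 2) := by
  refine tendsto_nhds_unique ((tendsto_qPoch hq a).mul (tendsto_qPoch hq (-a))) ?_
  simpa only [qPoch_mul_neg] using tendsto_qPoch (norm_pow_lt_one hq two_ne_zero) (a ^ 2)

theorem qPochInf_eq_mul_sq {q : ℂ} (hq : ‖q‖ < 1) (a : ℂ) :
    qPochInf a q = qPochInf a (q ^ 2) * qPochInf (a * q) (q ^ 2) := by
  have hq2 := norm_pow_lt_one hq two_ne_zero
  refine tendsto_nhds_unique ((tendsto_qPoch hq a).comp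
    (tendsto_id.const_mul_atTop' (r := 2) two_pos)) ?_
  simpa only [Function.comp_def, id, qPoch_two_mul] using
    (tendsto_qPoch hq2 a).mul (tendsto_qPoch hq2 (a * q))

theorem qPochInf_pow_eq_mul {q : ℂ} (hq : ‖q‖ < 1) (i : ℕ) {m : ℕ} (hm : m ≠ 0) :
    qPochInf (q ^ i) (q ^ m) =
      qPochInf (q ^ i) (q ^ (2 * m)) * qPochInf (q ^ (i + m)) (q ^ (2 * m)) := by
  rw [qPochInf_eq_mul_sq (norm_pow_lt_one hq hm), ← pow_mul, ← pow_add, mul_comm m 2]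

theorem qPochInf_pow_mul_neg {q : ℂ} (hq : ‖q‖ < 1) (i : ℕ) {m : ℕ} (hm : m ≠ 0) :
    qPochInf (q ^ i) (q ^ m) * qPochInf (-q ^ i) (q ^ m) =
      qPochInf (q ^ (2 * i)) (q ^ (2 * m)) := by
  rw [qPochInf_mul_neg (norm_pow_lt_one hq hm), ← pow_mul, ← pow_mul, mul_comm m 2, mul_comm i 2]

theorem qPochInf_pow_ne_zero {q : ℂ} (hq : ‖q‖ < 1) {i m : ℕ} (hi : i ≠ 0) (hm : m ≠ 0) :
    qPochInf (q ^ i) (q ^ m) ≠ 0 :=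
  qPochInf_ne_zero (norm_pow_lt_one hq hm) (norm_pow_lt_one hq hi)

/-! ### q-binomial coefficients and the finite q-binomial theorem. -/

theorem qBinom_add {q : ℂ} (n m : ℕ) :
    qBinom (n + m) n q = qPoch q q (n + m) / (qPoch q q n * qPoch q q m) := by
  simp [qBinom]

theorem qBinom_of_lt {N n : ℕ} (h : N < n) (q : ℂ) : qBinom N n q = 0 := by
  simp [qBinom, h]

theorem qBinom_zero_right {q : ℂ} (hq : ‖q‖ < 1) (N : ℕ) : qBinom N 0 q = 1 := by
  simp [qBinom, qPoch_zero, qPoch_ne_zero hq hq]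

theorem qBinom_self {q : ℂ} (hq : ‖q‖ < 1) (N : ℕ) : qBinom N N q = 1 := by
  simp [qBinom, qPoch_zero, qPoch_ne_zero hq hq]

theorem qBinom_succ_succ {q : ℂ} (hq : ‖q‖ < 1) {N n : ℕ} (h : n ≤ N) :
    qBinom (N + 1) (n + 1) q = qBinom N (n + 1) q + q ^ (N - n) * qBinom N n q := by
  obtain ⟨m, rfl⟩ := Nat.exists_eq_add_of_le h
  rcases m with _ | m
  · simp [qBinom_self hq, qBinom_of_lt]
  · rw [show n + (m + 1) + 1 = (n + 1) + (m + 1) by ring, qBinom_add, qBinom_add n (m + 1),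
      show n + (m + 1) = (n + 1) + m by ring, qBinom_add, show n + 1 + m - n = m + 1 by omega,
      show n + 1 + (m + 1) = n + 1 + m + 1 by ring, qPoch_succ q q (n + 1 + m), qPoch_succ q q n,
      qPoch_succ q q m]
    have h1 := qPoch_ne_zero hq hq n
    have h2 := qPoch_ne_zero hq hq m
    have h3 := one_sub_mul_pow_ne_zero hq hq n
    have h4 := one_sub_mul_pow_ne_zero hq hq m
    field_simp
    ring

theorem sum_qBinom {q : ℂ} (hq : ‖q‖ < 1) (z : ℂ) (N : ℕ) :
    ∑ r ∈ Finset.range (N + 1), z ^ r * q ^ r.choose 2 * qBinom N r q = qPoch (-z) q N := by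
  induction N with
  | zero => simp [qPoch_zero, qBinom_self hq]
  | succ N ih =>
    have key : ∀ r ∈ Finset.range (N + 1),
        z ^ (r + 1) * q ^ (r + 1).choose 2 * qBinom (N + 1) (r + 1) q =
          z ^ (r + 1) * q ^ (r + 1).choose 2 * qBinom N (r + 1) q +
            z * q ^ N * (z ^ r * q ^ r.choose 2 * qBinom N r q) := by
      intro r hr
      have hr' : r ≤ N := Nat.lt_succ_iff.mp (Finset.mem_range.mp hr)
      obtain ⟨m, rfl⟩ := Nat.exists_eq_add_of_le hr'
      rw [qBinom_succ_succ hq hr', Nat.choose_succ_succ' r 1, Nat.choose_one_right,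
        Nat.add_sub_cancel_left]
      ring
    rw [Finset.sum_range_succ', Finset.sum_congr rfl key, Finset.sum_add_distrib, ← Finset.mul_sum,
      ih, qPoch_succ, (qBinom_zero_right hq _).trans (qBinom_zero_right hq N).symm, add_right_comm,
      ← Finset.sum_range_succ' (fun r => z ^ r * q ^ r.choose 2 * qBinom N r q),
      Finset.sum_range_succ, ih, qBinom_of_lt (Nat.lt_succ_self N)]
    ring

theorem exists_norm_qBinom_le {q : ℂ} (hq : ‖q‖ < 1) :
    ∃ C : ℝ, 0 < C ∧ ∀ N n, ‖qBinom N n q‖ ≤ C := by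
  obtain ⟨C, hC, h⟩ := exists_norm_qPoch_le hq q
  obtain ⟨D, hD, h'⟩ := exists_norm_inv_qPoch_le hq hq
  refine ⟨C * (D * D), by positivity, fun N n => ?_⟩
  unfold qBinom
  split_ifs
  · rw [div_eq_mul_inv, mul_inv, norm_mul, norm_mul]
    gcongr <;> apply_assumption
  · simpa using by positivity

/-! ### Euler's expansion of `1 / (z; q)_∞`. -/

/-- Supplies the initial value when a functional equation is iterated: the terms with `n ≥ 1` die as
`k` grows, under the summable bound `C * r ^ n`. -/
theorem tendsto_tsum_of_norm_le_geometric {f : ℕ → ℕ → ℂ} {C r s : ℝ} (hr₀ : 0 ≤ r) (hr : r < 1)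
    (hs₀ : 0 ≤ s) (hs : s < 1) (h0 : ∀ k, f k 0 = 1)
    (h : ∀ k n, ‖f k n‖ ≤ C * r ^ n * (s ^ k) ^ n) :
    Tendsto (fun k => ∑' n, f k n) atTop (𝓝 1) := by
  have hC : 0 ≤ C := zero_le_one.trans (by simpa [h0] using h 0 0)
  have key := tendsto_tsum_of_dominated_convergence (𝓕 := atTop) (f := f)
    (g := fun n => if n = 0 then 1 else 0) (bound := fun n => C * r ^ n)
    ((summable_geometric_of_lt_one hr₀ hr).mul_left C) ?_ ?_
  · simpa using key
  · intro n
    rcases n with _ | n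
    · simp [h0]
    · refine squeeze_zero_norm (a := fun k => C * r ^ (n + 1) * (s ^ k) ^ (n + 1))
        (fun k => h k _) ?_
      simpa using ((tendsto_pow_atTop_nhds_zero_of_lt_one hs₀ hs).pow (n + 1)).const_mul
        (C * r ^ (n + 1))
  · refine Eventually.of_forall fun k n => (h k n).trans ?_
    exact mul_le_of_le_one_right (by positivity)
      (pow_le_one₀ (by positivity) (pow_le_one₀ hs₀ hs.le))

theorem summable_pow_div_qPoch {q z : ℂ} (hq : ‖q‖ < 1) (hz : ‖z‖ < 1) :
    Summable fun n => z ^ n / qPoch q q n := by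
  obtain ⟨D, hD, h'⟩ := exists_norm_inv_qPoch_le hq hq
  refine Summable.of_norm_bounded ((summable_geometric_of_lt_one (norm_nonneg z) hz).mul_left D)
    fun n => ?_
  rw [div_eq_mul_inv, norm_mul, norm_pow, mul_comm]
  gcongr
  exact h' n

theorem tsum_pow_div_qPoch {q z : ℂ} (hq : ‖q‖ < 1) (hz : ‖z‖ < 1) :
    ∑' n, z ^ n / qPoch q q n = (qPochInf z q)⁻¹ := by
  have hzk : ∀ k, ‖z * q ^ k‖ < 1 := fun k => by
    rw [norm_mul, norm_pow]
    exact (mul_le_of_le_one_right (norm_nonneg z) (pow_le_one₀ (norm_nonneg q) hq.le)).trans_lt hz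
  -- Functional equation `S(wq) = (1 - w) S(w)`: the factor `1 - q ^ n` in `w ^ n - (w * q) ^ n`
  -- cancels the last factor of the denominator and shifts the index by one.
  have step : ∀ w : ℂ, ‖w‖ < 1 → ‖w * q‖ < 1 →
      ∑' n, (w * q) ^ n / qPoch q q n = (1 - w) * ∑' n, w ^ n / qPoch q q n := by
    intro w hw hwq
    have hs := summable_pow_div_qPoch hq hw
    have hs' := summable_pow_div_qPoch hq hwq
    have : ∑' n, (w ^ n / qPoch q q n - (w * q) ^ n / qPoch q q n) =
        w * ∑' n, w ^ n / qPoch q q n := by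
      rw [(hs.sub hs').tsum_eq_zero_add, ← tsum_mul_left]
      simp only [pow_zero, sub_self, zero_add]
      refine tsum_congr fun n => ?_
      have h1 := qPoch_ne_zero hq hq n
      have h2 := one_sub_mul_pow_ne_zero hq hq n
      rw [qPoch_succ]
      field_simp
      ring
    rw [hs.tsum_sub hs'] at this
    linear_combination -this
  have iter : ∀ k, ∑' n, (z * q ^ k) ^ n / qPoch q q n =
      qPoch z q k * ∑' n, z ^ n / qPoch q q n := by
    intro k
    induction k with
    | zero => simp [qPoch_zero]
    | succ k ih =>
      have := step (z * q ^ k) (hzk k) (by simpa [pow_succ, mul_assoc] using hzk (k + 1))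
      rw [pow_succ, ← mul_assoc, this, ih, qPoch_succ]
      ring
  have lim1 : Tendsto (fun k => ∑' n, (z * q ^ k) ^ n / qPoch q q n) atTop (𝓝 1) := by
    obtain ⟨D, hD, h'⟩ := exists_norm_inv_qPoch_le hq hq
    refine tendsto_tsum_of_norm_le_geometric (C := D) (norm_nonneg z) hz (norm_nonneg q) hq
      (fun k => by simp [qPoch_zero]) fun k n => ?_
    rw [div_eq_mul_inv, norm_mul, mul_comm, norm_pow, norm_mul, norm_pow, mul_pow, mul_assoc D]
    gcongr
    exact h' n
  simp only [iter] at lim1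
  have := tendsto_nhds_unique lim1 ((tendsto_qPoch hq z).mul_const _)
  exact eq_inv_of_mul_eq_one_right this.symm

/-! ### The Jacobi triple product. -/

/-- This is Mathlib's two-variable theta series with nome `x = exp(πiτ)`; `‖x‖ < 1` means that `τ =
log x / (πi)` lies in the upper half plane. -/
theorem summable_zpow_mul_zpow_sq {x z : ℂ} (hx : ‖x‖ < 1) (hx₀ : x ≠ 0) (hz : z ≠ 0) :
    Summable fun k : ℤ => z ^ k * x ^ (k ^ 2) := by
  have hpi : (Real.pi : ℂ) ≠ 0 := by exact_mod_cast Real.pi_ne_zero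
  have him : 0 < (Complex.log x / (Real.pi * Complex.I)).im := by
    have : Complex.log x / (Real.pi * Complex.I) =
        ((Real.pi⁻¹ : ℝ) : ℂ) * (-(Complex.I * Complex.log x)) := by
      push_cast
      field_simp
      rw [Complex.I_sq]
      ring
    rw [this, Complex.im_ofReal_mul]
    have hlog := Real.log_neg (norm_pos_iff.mpr hx₀) hx
    have : 0 < Real.pi⁻¹ := inv_pos.mpr Real.pi_pos
    simpa [Complex.log_re] using mul_neg_of_pos_of_neg this hlog
  refine ((summable_jacobiTheta₂_term_iff (Complex.log z / (2 * Real.pi * Complex.I)) _).mpr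
    him).congr fun k => ?_
  rw [jacobiTheta₂_term, Complex.exp_add]
  congr 1
  · rw [show 2 * (Real.pi : ℂ) * Complex.I * k * (Complex.log z / (2 * Real.pi * Complex.I)) =
      k * Complex.log z by field_simp, Complex.exp_int_mul, Complex.exp_log hz]
  · rw [show (Real.pi : ℂ) * Complex.I * k ^ 2 * (Complex.log x / (Real.pi * Complex.I)) =
      ((k ^ 2 : ℤ) : ℂ) * Complex.log x by push_cast; field_simp, Complex.exp_int_mul,
      Complex.exp_log hx₀]

theorem pow_choose_two_mul_pow (x : ℂ) (r : ℕ) : (x ^ 2) ^ r.choose 2 * x ^ r = x ^ (r ^ 2) := by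
  have hc : 2 * r.choose 2 + r = r ^ 2 := by
    have := Nat.choose_two_right r
    have h2 := Nat.div_mul_cancel (Nat.even_mul_pred_self r).two_dvd
    rcases r with _ | r
    · rfl
    · simp only [Nat.add_sub_cancel] at *
      nlinarith
  rw [← pow_mul, ← pow_add, hc]

/-- The finite `q`-binomial theorem with the quadratic exponent centred at `n`. -/
theorem sum_centred_qBinom {x : ℂ} (hx : ‖x‖ < 1) (hx₀ : x ≠ 0) (z : ℂ) (n N : ℕ) :
    ∑ r ∈ Finset.range (N + 1), z ^ r * x ^ (((r : ℤ) - n) ^ 2) * qBinom N r (x ^ 2) =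
      x ^ (n ^ 2) * qPoch (-(z * x / (x ^ 2) ^ n)) (x ^ 2) N := by
  rw [← sum_qBinom (norm_pow_lt_one hx two_ne_zero), Finset.mul_sum]
  refine Finset.sum_congr rfl fun r _ => ?_
  have hx3 : x ^ (((r : ℤ) - n) ^ 2) = x ^ (r ^ 2) * x ^ (n ^ 2) / x ^ (2 * n * r) := by
    rw [eq_div_iff (pow_ne_zero _ hx₀), ← zpow_natCast, ← zpow_natCast, ← zpow_natCast,
      ← zpow_add₀ hx₀, ← zpow_add₀ hx₀]
    congr 1
    push_cast
    ring
  rw [hx3, ← pow_choose_two_mul_pow x r, div_pow, mul_pow, ← pow_mul, ← pow_mul, ← pow_mul]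
  field_simp
  ring

/-- Each factor `1 + z x^(1-2j)` equals `z x^(1-2j) (1 + x^(2j-1) / z)`, and the odd numbers `2j -
1` with `j ≤ n` add up to `n ^ 2`. -/
theorem qPoch_neg_div_pow {x z : ℂ} (hx₀ : x ≠ 0) (hz : z ≠ 0) (n : ℕ) :
    qPoch (-(z * x / (x ^ 2) ^ n)) (x ^ 2) n * x ^ (n ^ 2) =
      z ^ n * qPoch (-(x / z)) (x ^ 2) n := by
  induction n with
  | zero => simp [qPoch_zero]
  | succ n ih =>
    have h : -(z * x / (x ^ 2) ^ (n + 1)) * x ^ 2 = -(z * x / (x ^ 2) ^ n) := by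
      field_simp
      ring
    rw [qPoch_succ', h, qPoch_succ, show (n + 1) ^ 2 = n ^ 2 + (2 * n + 1) by ring, pow_add]
    calc _ = (1 - -(z * x / (x ^ 2) ^ (n + 1))) * x ^ (2 * n + 1) *
          (qPoch (-(z * x / (x ^ 2) ^ n)) (x ^ 2) n * x ^ (n ^ 2)) := by ring
      _ = _ := by
        rw [ih]
        field_simp
        ring

/-- Finite form of the triple product: the q-binomial theorem with `N = 2 * n`, centred in the
middle, whose product splits into two halves, the first reversed. -/
theorem sum_Icc_jacobi {x z : ℂ} (hx : ‖x‖ < 1) (hx₀ : x ≠ 0) (hz : z ≠ 0) (n : ℕ) :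
    ∑ k ∈ Finset.Icc (-(n : ℤ)) n, z ^ k * x ^ (k ^ 2) * qBinom (2 * n) (n + k).toNat (x ^ 2) =
      qPoch (-(z * x)) (x ^ 2) n * qPoch (-(x / z)) (x ^ 2) n := by
  have h := sum_centred_qBinom hx hx₀ z n (2 * n)
  have hprod : qPoch (-(z * x / (x ^ 2) ^ n)) (x ^ 2) (2 * n) * x ^ (n ^ 2) =
      z ^ n * (qPoch (-(z * x)) (x ^ 2) n * qPoch (-(x / z)) (x ^ 2) n) := by
    rw [two_mul, qPoch_add, show -(z * x / (x ^ 2) ^ n) * (x ^ 2) ^ n = -(z * x) by field_simp]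
    linear_combination qPoch (-(z * x)) (x ^ 2) n * qPoch_neg_div_pow hx₀ hz n
  rw [mul_comm, ← h] at hprod
  refine mul_left_cancel₀ (pow_ne_zero n hz) (Eq.trans ?_ hprod)
  rw [Finset.mul_sum]
  refine Finset.sum_bij' (fun k _ => (n + k).toNat) (fun r _ => (r : ℤ) - n) ?_ ?_ ?_ ?_ ?_
  · intro k hk
    simp only [Finset.mem_Icc, Finset.mem_range] at hk ⊢
    omega
  · intro r hr
    simp only [Finset.mem_Icc, Finset.mem_range] at hr ⊢
    omega
  · intro k hk
    simp only [Finset.mem_Icc] at hk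
    omega
  · intro r hr
    omega
  · intro k hk
    obtain ⟨r, hr⟩ : ∃ r : ℕ, (r : ℤ) = n + k :=
      ⟨(n + k).toNat, Int.toNat_of_nonneg (by simp only [Finset.mem_Icc] at hk; omega)⟩
    obtain rfl : k = r - n := by omega
    rw [show ((n : ℤ) + (r - n)).toNat = r by omega]
    rw [zpow_sub₀ hz, zpow_natCast, zpow_natCast]
    field_simp

/-- The Jacobi triple product identity. -/
theorem tsum_jacobi {x z : ℂ} (hx : ‖x‖ < 1) (hx₀ : x ≠ 0) (hz : z ≠ 0) :
    ∑' k : ℤ, z ^ k * x ^ (k ^ 2) =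
      qPochInf (x ^ 2) (x ^ 2) * qPochInf (-(z * x)) (x ^ 2) * qPochInf (-(x / z)) (x ^ 2) := by
  have hq := norm_pow_lt_one hx two_ne_zero
  have hP := qPochInf_ne_zero hq hq
  have hs := summable_zpow_mul_zpow_sq hx hx₀ hz
  obtain ⟨C, hC, hb⟩ := exists_norm_qBinom_le hq
  -- The finite sums are extended by zero to all of `ℤ`, so that dominated convergence applies.
  let F : ℕ → ℤ → ℂ := fun n k => if k ∈ Finset.Icc (-(n : ℤ)) n then
    z ^ k * x ^ (k ^ 2) * qBinom (2 * n) (n + k).toNat (x ^ 2) else 0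
  have hF : ∀ n, ∑' k, F n k =
      qPoch (-(z * x)) (x ^ 2) n * qPoch (-(x / z)) (x ^ 2) n := by
    intro n
    rw [← sum_Icc_jacobi hx hx₀ hz, tsum_eq_sum (s := Finset.Icc (-(n : ℤ)) n)]
    · exact Finset.sum_congr rfl fun k hk => by simp only [F, if_pos hk]
    · intro k hk
      simp only [F, if_neg hk]
  have lim := tendsto_tsum_of_dominated_convergence (𝓕 := atTop) (f := F)
    (g := fun k => z ^ k * x ^ (k ^ 2) * (qPochInf (x ^ 2) (x ^ 2))⁻¹)
    (bound := fun k => ‖z ^ k * x ^ (k ^ 2)‖ * C) (hs.norm.mul_right C) ?_ ?_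
  · simp only [hF, tsum_mul_right] at lim
    have := tendsto_nhds_unique lim ((tendsto_qPoch hq _).mul (tendsto_qPoch hq _))
    rw [mul_inv_eq_iff_eq_mul₀ hP] at this
    rw [this]
    ring
  · intro k
    have t := tendsto_qPoch hq (x ^ 2)
    have h1 : Tendsto (fun n : ℕ => 2 * n) atTop atTop :=
      tendsto_atTop_mono (fun n => by simp only [id]; omega) tendsto_id
    have h2 : Tendsto (fun n : ℕ => (n + k).toNat) atTop atTop :=
      tendsto_atTop_mono (fun n => by omega) (tendsto_sub_atTop_nat k.natAbs)
    have h3 : Tendsto (fun n : ℕ => (n - k).toNat) atTop atTop :=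
      tendsto_atTop_mono (fun n => by omega) (tendsto_sub_atTop_nat k.natAbs)
    have key := ((t.comp h1).div ((t.comp h2).mul (t.comp h3)) (mul_ne_zero hP hP)).const_mul
      (z ^ k * x ^ (k ^ 2))
    rw [div_mul_cancel_left₀ hP] at key
    refine key.congr' ?_
    filter_upwards [eventually_ge_atTop k.natAbs] with n hn
    have hk : k ∈ Finset.Icc (-(n : ℤ)) n := by
      rw [Finset.mem_Icc]
      omega
    simp only [F, if_pos hk, Function.comp_apply]
    rw [qBinom, if_pos (by omega), show 2 * n - (n + k).toNat = (n - k).toNat by omega]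
    rfl
  · refine Eventually.of_forall fun n k => ?_
    simp only [F]
    split_ifs
    · rw [norm_mul]
      gcongr
      exact hb _ _
    · simpa using by positivity

/-! ### The q-analogue of Bailey's sum. -/

/-- The summand of the `q`-analogue of Bailey's summation theorem. -/
noncomputable def qBaileyTerm (a c q b : ℂ) (n : ℕ) : ℂ :=
  qPoch a q n * qPoch c q n * b ^ n * q ^ n.choose 2 / (qPoch (q ^ 2) (q ^ 2) n * qPoch b q n)

theorem norm_mul_pow_lt_one {q b : ℂ} (hq : ‖q‖ < 1) (hb : ‖b‖ < 1) (k : ℕ) :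
    ‖b * q ^ k‖ < 1 := by
  rw [norm_mul, norm_pow]
  exact (mul_le_of_le_one_right (norm_nonneg b) (pow_le_one₀ (norm_nonneg q) hq.le)).trans_lt hb

theorem exists_norm_qBaileyTerm_le {q b : ℂ} (hq : ‖q‖ < 1) (hb : ‖b‖ < 1) (a c : ℂ) :
    ∃ C : ℝ, 0 < C ∧ ∀ k n, ‖qBaileyTerm a c q (b * q ^ k) n‖ ≤ C * ‖b‖ ^ n * (‖q‖ ^ k) ^ n := by
  obtain ⟨A, hA, hA'⟩ := exists_norm_qPoch_le hq a
  obtain ⟨B, hB, hB'⟩ := exists_norm_qPoch_le hq c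
  obtain ⟨D, hD, hD'⟩ := exists_norm_inv_qPoch_le (norm_pow_lt_one hq two_ne_zero)
    (norm_pow_lt_one hq two_ne_zero)
  obtain ⟨E, hE, hE'⟩ := exists_norm_qPoch_le hq b
  obtain ⟨G, hG, hG'⟩ := exists_norm_inv_qPoch_le hq hb
  refine ⟨A * B * 1 * D * (E * G), by positivity, fun k n => ?_⟩
  -- Rewriting the denominator through `(b; q)_{k+n}` makes its bound uniform in `k`.
  have h1 : (qPoch (b * q ^ k) q n)⁻¹ = qPoch b q k * (qPoch b q (k + n))⁻¹ := by
    rw [qPoch_add, mul_inv, mul_inv_cancel_left₀ (qPoch_ne_zero hq hb k)]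
  have h2 : ‖q ^ n.choose 2‖ ≤ 1 := by
    rw [norm_pow]
    exact pow_le_one₀ (norm_nonneg q) hq.le
  calc ‖qBaileyTerm a c q (b * q ^ k) n‖
      = ‖qPoch a q n‖ * ‖qPoch c q n‖ * ‖q ^ n.choose 2‖ * ‖(qPoch (q ^ 2) (q ^ 2) n)⁻¹‖ *
          (‖qPoch b q k‖ * ‖(qPoch b q (k + n))⁻¹‖) * ‖b‖ ^ n * (‖q‖ ^ k) ^ n := by
        rw [qBaileyTerm, div_eq_mul_inv, mul_inv, h1]
        simp only [norm_mul, norm_pow, mul_pow]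
        ring
    _ ≤ _ := by
        gcongr
        exacts [hA' _, hB' _, hD' _, hE' _, hG' _]

theorem summable_qBaileyTerm {q b : ℂ} (hq : ‖q‖ < 1) (hb : ‖b‖ < 1) (a c : ℂ) :
    Summable (qBaileyTerm a c q b) := by
  obtain ⟨C, hC, h⟩ := exists_norm_qBaileyTerm_le hq hb a c
  exact Summable.of_norm_bounded ((summable_geometric_of_lt_one (norm_nonneg b) hb).mul_left C)
    fun n => by simpa using h 0 n

theorem qBaileyTerm_comm (a c q b : ℂ) : qBaileyTerm a c q b = qBaileyTerm c a q b := by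
  funext n
  rw [qBaileyTerm, qBaileyTerm, mul_comm (qPoch a q n)]

/-- Telescoping certificate for the contiguous relation: the right side is a bounded factor times a
summand and vanishes as `n` grows, so only the shift of parameters remains. -/
theorem sum_qBaileyTerm_sub {q b a : ℂ} (hq : ‖q‖ < 1) (hb : ‖b‖ < 1) (ha : a ≠ 0) (n : ℕ) :
    ∑ i ∈ Finset.range (n + 1), (qBaileyTerm a (q / a) q b i -
        (1 - a * b) / (1 - b) * qBaileyTerm (a * q) a⁻¹ q (b * q) i) =
      -(b * q ^ n * (1 - a * q ^ n) / (1 - b * q ^ n)) * qBaileyTerm a (q / a) q b n := by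
  have hb' := one_sub_mul_pow_ne_zero hq hb
  have hb1 : 1 - b ≠ 0 := by simpa using hb' 0
  induction n with
  | zero =>
    simp [qBaileyTerm, qPoch_zero]
    field_simp
    ring
  | succ n ih =>
    rw [Finset.sum_range_succ, ih]
    have hq2 := norm_pow_lt_one hq two_ne_zero
    have e1 : qPoch (a * q) q (n + 1) * qPoch a⁻¹ q (n + 1) =
        -(qPoch a q n * (1 - a * q ^ n) * (1 - a * q ^ (n + 1)) * qPoch (q / a) q n) / a := by
      rw [← qPoch_succ, ← qPoch_succ, qPoch_succ' a q (n + 1), qPoch_succ' a⁻¹,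
        inv_mul_eq_div]
      field_simp
      ring
    have e2 : qPoch (b * q) q (n + 1) =
        qPoch b q n * (1 - b * q ^ n) * (1 - b * q ^ (n + 1)) / (1 - b) := by
      rw [eq_div_iff hb1, ← qPoch_succ, ← qPoch_succ, qPoch_succ' b q (n + 1)]
      ring
    have h0 := qPoch_ne_zero hq2 hq2 n
    have h1 := qPoch_ne_zero hq hb n
    have h2 := one_sub_mul_pow_ne_zero hq2 hq2 n
    have h3 := hb' n
    have h4 := hb' (n + 1)
    simp only [qBaileyTerm]
    rw [e1, e2, qPoch_succ a, qPoch_succ (q / a), qPoch_succ (q ^ 2), qPoch_succ b,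
      Nat.choose_succ_succ' n 1, Nat.choose_one_right, pow_add q n]
    generalize qPoch a q n = A at *
    generalize qPoch (q / a) q n = B at *
    generalize qPoch b q n = D at *
    generalize qPoch (q ^ 2) (q ^ 2) n = E at *
    generalize q ^ n.choose 2 = G at *
    have e3 : (q ^ 2) ^ n = (q ^ n) ^ 2 := by ring
    have e4 : (b * q) ^ (n + 1) = b ^ n * b * (q ^ n * q) := by ring
    clear ih e1 e2
    rw [e3] at h2
    rw [e3, e4, pow_succ b n]
    rw [pow_succ q n] at h4 ⊢
    clear e3 e4
    generalize q ^ n = x at *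
    generalize b ^ n = y at *
    have h5 : 1 - b * x * q ≠ 0 := by rwa [mul_assoc]
    have h6 : 1 - x ^ 2 * q ^ 2 ≠ 0 := by rwa [mul_comm (x ^ 2)]
    field_simp
    ring

theorem tsum_qBaileyTerm_shift {q b a : ℂ} (hq : ‖q‖ < 1) (hb : ‖b‖ < 1) (ha : a ≠ 0) :
    ∑' n, qBaileyTerm a (q / a) q b n =
      (1 - a * b) / (1 - b) * ∑' n, qBaileyTerm (a * q) a⁻¹ q (b * q) n := by
  have hbq : ‖b * q‖ < 1 := by simpa using norm_mul_pow_lt_one hq hb 1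
  have hs := summable_qBaileyTerm hq hb a (q / a)
  have hs' := (summable_qBaileyTerm hq hbq (a * q) a⁻¹).mul_left ((1 - a * b) / (1 - b))
  have h1 := ((hs.sub hs').hasSum.tendsto_sum_nat).comp (tendsto_add_atTop_nat 1)
  simp only [Function.comp_def, sum_qBaileyTerm_sub hq hb ha] at h1
  have hx : Tendsto (fun n => q ^ n) atTop (𝓝 0) := tendsto_pow_atTop_nhds_zero_of_norm_lt_one hq
  have h2 : Tendsto (fun n : ℕ => -(b * q ^ n * (1 - a * q ^ n) / (1 - b * q ^ n)) *
      qBaileyTerm a (q / a) q b n) atTop (𝓝 (-(b * 0 * (1 - a * 0) / (1 - b * 0)) * 0)) :=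
    ((((hx.const_mul b).mul ((hx.const_mul a).const_sub 1)).div
      ((hx.const_mul b).const_sub 1) (by simp)).neg).mul hs.tendsto_atTop_zero
  have h3 := tendsto_nhds_unique h1 h2
  rw [hs.tsum_sub hs', tsum_mul_left] at h3
  simpa [sub_eq_zero] using h3

/-- The `q`-analogue of Bailey's summation theorem. -/
theorem tsum_qBaileyTerm {q b a : ℂ} (hq : ‖q‖ < 1) (hb : ‖b‖ < 1) (ha : a ≠ 0) :
    ∑' n, qBaileyTerm a (q / a) q b n =
      qPochInf (a * b) (q ^ 2) * qPochInf (b * q / a) (q ^ 2) / qPochInf b q := by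
  have hq2 := norm_pow_lt_one hq two_ne_zero
  have step : ∀ w : ℂ, ‖w‖ < 1 → ∑' n, qBaileyTerm a (q / a) q w n =
      (1 - a * w) * (1 - w * q / a) / ((1 - w) * (1 - w * q)) *
        ∑' n, qBaileyTerm a (q / a) q (w * q ^ 2) n := by
    intro w hw
    have hwq : ‖w * q‖ < 1 := by simpa using norm_mul_pow_lt_one hq hw 1
    -- The first shift leaves the parameters `a * q, a⁻¹`. Interchanged, they have the form `a', q /
    -- a'` with `a' = a⁻¹`, so a second shift restores `a, q / a` with `w` multiplied by `q ^ 2`.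
    have h := tsum_qBaileyTerm_shift hq hwq (inv_ne_zero ha)
    rw [div_inv_eq_mul, inv_inv, inv_mul_eq_div, mul_comm q a, qBaileyTerm_comm a⁻¹,
      qBaileyTerm_comm (a⁻¹ * q), inv_mul_eq_div] at h
    rw [tsum_qBaileyTerm_shift hq hw ha, h, mul_assoc w, ← sq]
    field_simp
  have iter : ∀ k : ℕ, qPoch b q (2 * k) * ∑' n, qBaileyTerm a (q / a) q b n =
      qPoch (a * b) (q ^ 2) k * qPoch (b * q / a) (q ^ 2) k *
        ∑' n, qBaileyTerm a (q / a) q (b * (q ^ 2) ^ k) n := by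
    intro k
    induction k with
    | zero => simp [qPoch_zero]
    | succ k ih =>
      have hk := norm_mul_pow_lt_one hq2 hb k
      have h1 := one_sub_mul_pow_ne_zero hq2 hb k
      have h2 := one_sub_mul_pow_ne_zero hq hb (2 * k + 1)
      rw [step _ hk] at ih
      rw [show 2 * (k + 1) = 2 * k + 1 + 1 by ring, qPoch_succ, qPoch_succ, qPoch_succ, qPoch_succ,
        mul_assoc _ (1 - _) (1 - _), mul_right_comm, ih, pow_succ (q ^ 2), ← mul_assoc b,
        pow_mul q 2 k, show q ^ (2 * k + 1) = (q ^ 2) ^ k * q by ring]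
      rw [show q ^ (2 * k + 1) = (q ^ 2) ^ k * q by ring] at h2
      rw [mul_assoc b]
      rw [mul_comm _ q, ← mul_assoc] at h2
      field_simp
  obtain ⟨C, hC, h⟩ := exists_norm_qBaileyTerm_le hq hb a (q / a)
  have lim : Tendsto (fun k : ℕ => ∑' n, qBaileyTerm a (q / a) q (b * (q ^ 2) ^ k) n) atTop
      (𝓝 1) := by
    refine tendsto_tsum_of_norm_le_geometric (C := C) (s := ‖q ^ 2‖) (norm_nonneg b) hb
      (norm_nonneg _) hq2 (fun k => by simp [qBaileyTerm, qPoch_zero]) fun k n => ?_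
    rw [norm_pow, ← pow_mul q, ← pow_mul ‖q‖ 2 k]
    exact h (2 * k) n
  have h1 := ((tendsto_qPoch hq2 (a * b)).mul (tendsto_qPoch hq2 (b * q / a))).mul lim
  simp only [← iter] at h1
  have h2 := ((tendsto_qPoch hq b).comp
    (tendsto_id.const_mul_atTop' (r := 2) two_pos)).mul_const
      (∑' n, qBaileyTerm a (q / a) q b n)
  rw [eq_div_iff (qPochInf_ne_zero hq hb), mul_comm, tendsto_nhds_unique h2 h1, mul_one]

/-! ### Parity splitting and the merged double series. -/

theorem tsum_eq_add_of_isCompl_range {α β : Type*} {f : α → ℂ} {g h : β → α}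
    (hg : g.Injective) (hh : h.Injective) (hc : IsCompl (Set.range g) (Set.range h))
    (hf : Summable f) : ∑' x, f x = ∑' x, f (g x) + ∑' x, f (h x) :=
  (HasSum.add_isCompl hc (hg.hasSum_range_iff.mpr (hf.comp_injective hg).hasSum)
    (hh.hasSum_range_iff.mpr (hf.comp_injective hh).hasSum)).tsum_eq

theorem isCompl_range_int_two_mul :
    IsCompl (Set.range fun k : ℤ => 2 * k) (Set.range fun k : ℤ => 2 * k + 1) := by
  rw [isCompl_iff, Set.disjoint_left, codisjoint_iff_le_sup]
  refine ⟨?_, fun k _ => ?_⟩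
  · rintro _ ⟨k, rfl⟩ ⟨l, hl⟩
    simp only at hl
    omega
  · rcases Int.even_or_odd' k with ⟨l, rfl | rfl⟩
    exacts [Or.inl ⟨l, rfl⟩, Or.inr ⟨l, rfl⟩]

theorem isCompl_range_nat_prod_two_mul :
    IsCompl (Set.range fun p : ℕ × ℕ => (2 * p.1, p.2))
      (Set.range fun p : ℕ × ℕ => (2 * p.1 + 1, p.2)) := by
  rw [isCompl_iff, Set.disjoint_left, codisjoint_iff_le_sup]
  refine ⟨?_, fun p _ => ?_⟩
  · rintro _ ⟨k, rfl⟩ ⟨l, hl⟩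
    simp only [Prod.mk.injEq] at hl
    omega
  · obtain ⟨r, b⟩ := p
    rcases Nat.even_or_odd' r with ⟨l, rfl | rfl⟩
    exacts [Or.inl ⟨(l, b), rfl⟩, Or.inr ⟨(l, b), rfl⟩]

/-- The double series summand, with the two parities of the first index merged. -/
noncomputable def cubicTerm (y : ℂ) (p : ℕ × ℕ) : ℂ :=
  y ^ (((p.1 : ℤ) - 3 * p.2) ^ 2 + 3 * (p.2 : ℤ) ^ 2) / qPoch (y ^ 6) (y ^ 6) (2 * p.2) *
    qBinom (3 * p.2) p.1 (y ^ 2)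

theorem summable_cubicTerm {y : ℂ} (hy : ‖y‖ < 1) (hy₀ : y ≠ 0) : Summable (cubicTerm y) := by
  have h6 := norm_pow_lt_one hy (show 6 ≠ 0 by norm_num)
  obtain ⟨B, hB, hB'⟩ := exists_norm_qBinom_le (norm_pow_lt_one hy two_ne_zero)
  obtain ⟨D, hD, hD'⟩ := exists_norm_inv_qPoch_le h6 h6
  have hg := summable_geometric_of_lt_one (norm_nonneg y) hy
  have hpos := norm_pos_iff.mpr hy₀
  refine Summable.of_norm_bounded ((hg.mul_of_nonneg hg (fun _ => by positivity)
    (fun _ => by positivity)).mul_left (‖y‖⁻¹ * D * B)) fun p => ?_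
  obtain ⟨r, b⟩ := p
  -- The exponent is at least `r + b - 1`, since `3b^2 - 4b + 1 = (3b - 1)(b - 1) ≥ 0`; equality
  -- occurs at `b = 1`, `r = 3`.
  have hpow : ‖y ^ (((r : ℤ) - 3 * b) ^ 2 + 3 * (b : ℤ) ^ 2)‖ ≤ ‖y‖⁻¹ * (‖y‖ ^ r * ‖y‖ ^ b) := by
    have : ‖y‖⁻¹ * (‖y‖ ^ r * ‖y‖ ^ b) = ‖y‖ ^ (-1 + (r + b) : ℤ) := by
      rw [zpow_add₀ hpos.ne', zpow_add₀ hpos.ne', zpow_neg_one, zpow_natCast, zpow_natCast]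
    rw [this, norm_zpow]
    refine zpow_le_zpow_right_of_le_one₀ hpos hy.le ?_
    have h1 : ((r : ℤ) - 3 * b) ≤ ((r : ℤ) - 3 * b) ^ 2 := Int.le_self_sq _
    have h2 : (b : ℤ) ≤ (b : ℤ) ^ 2 := Int.le_self_sq _
    rcases Nat.eq_zero_or_pos b with rfl | hb
    · push_cast at *
      linarith
    · nlinarith
  calc ‖cubicTerm y (r, b)‖
      = ‖y ^ (((r : ℤ) - 3 * b) ^ 2 + 3 * (b : ℤ) ^ 2)‖ *
          ‖(qPoch (y ^ 6) (y ^ 6) (2 * b))⁻¹‖ * ‖qBinom (3 * b) r (y ^ 2)‖ := by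
        rw [cubicTerm, div_eq_mul_inv, norm_mul, norm_mul]
    _ ≤ ‖y‖⁻¹ * (‖y‖ ^ r * ‖y‖ ^ b) * D * B := by
        gcongr
        exacts [hD' _, hB' _ _]
    _ = _ := by ring

theorem tsum_cubicTerm_fst {y : ℂ} (hy : ‖y‖ < 1) (hy₀ : y ≠ 0) (b : ℕ) :
    ∑' r, cubicTerm y (r, b) = qBaileyTerm (-y) (y ^ 6 / -y) (y ^ 6) (y ^ 3) b := by
  have h3 := norm_pow_lt_one hy three_ne_zero
  have h6 := norm_pow_lt_one hy (show 6 ≠ 0 by norm_num)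
  have h12 := norm_pow_lt_one hy (show 12 ≠ 0 by norm_num)
  rw [tsum_eq_sum (s := Finset.range (3 * b + 1)) fun r hr => by
    rw [cubicTerm, qBinom_of_lt (by simpa using hr), mul_zero]]
  -- Centre and length are both `3 * b`, so the whole product has negative exponents and is reversed
  -- at once.
  have hsum := sum_centred_qBinom hy hy₀ 1 (3 * b) (3 * b)
  have hrev := qPoch_neg_div_pow hy₀ one_ne_zero (3 * b)
  rw [mul_comm, ← hsum, one_pow, one_mul, div_one] at hrev
  have hterm : ∀ r ∈ Finset.range (3 * b + 1), cubicTerm y (r, b) =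
      y ^ (3 * b ^ 2) / qPoch (y ^ 6) (y ^ 6) (2 * b) *
        (1 ^ r * y ^ (((r : ℤ) - (3 * b : ℕ)) ^ 2) * qBinom (3 * b) r (y ^ 2)) := by
    intro r _
    have e : y ^ (3 * (b : ℤ) ^ 2) = y ^ (3 * b ^ 2) := by
      rw [← zpow_natCast]
      push_cast
      rfl
    rw [cubicTerm, zpow_add₀ hy₀, e]
    push_cast
    ring
  rw [Finset.sum_congr rfl hterm, ← Finset.mul_sum, hrev, qPoch_three_mul, qPoch_two_mul,
    qBaileyTerm, ← pow_mul, ← pow_mul, ← pow_add, ← pow_mul]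
  norm_num only
  have e1 : qPoch (y ^ 6) (y ^ 12) b = qPoch (y ^ 3) (y ^ 6) b * qPoch (-y ^ 3) (y ^ 6) b := by
    rw [qPoch_mul_neg, ← pow_mul, ← pow_mul]
  have e2 : y ^ 6 / -y = -y * (y ^ 2) ^ 2 := by
    field_simp
  have e3 : y ^ (3 * b ^ 2) = (y ^ 3) ^ b * (y ^ 6) ^ b.choose 2 := by
    rw [pow_mul y 3, ← pow_choose_two_mul_pow, mul_comm, ← pow_mul y 3 2]
  have e4 : -y * y ^ 2 = -y ^ 3 := by ring
  rw [e1, e2, e3, e4]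
  have n1 := qPoch_ne_zero h6 h3 b
  have n2 := qPoch_ne_zero h6 (show ‖-y ^ 3‖ < 1 by rwa [norm_neg]) b
  have n3 := qPoch_ne_zero h12 h12 b
  field_simp

theorem tsum_cubicTerm {y : ℂ} (hy : ‖y‖ < 1) (hy₀ : y ≠ 0) :
    ∑' p, cubicTerm y p =
      qPochInf (-y ^ 4) (y ^ 12) * qPochInf (-y ^ 8) (y ^ 12) * (qPochInf (y ^ 3) (y ^ 6))⁻¹ := by
  have hs := summable_cubicTerm hy hy₀
  have hswap : ∑' p, cubicTerm y p = ∑' b, ∑' r, cubicTerm y (r, b) := by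
    rw [← (Equiv.prodComm ℕ ℕ).tsum_eq (cubicTerm y)]
    exact ((Equiv.prodComm ℕ ℕ).summable_iff.mpr hs).tsum_prod
  simp only [hswap, tsum_cubicTerm_fst hy hy₀]
  rw [tsum_qBaileyTerm (norm_pow_lt_one hy (by norm_num)) (norm_pow_lt_one hy three_ne_zero)
    (neg_ne_zero.mpr hy₀), div_eq_mul_inv]
  congr 3
  · ring
  · ring
  · field_simp
  · ring

/-! ### Product formulas for the two single series. -/

theorem eq_and_eq_of_add_mul_of_sub_mul {a b c d t : ℂ} (ht : t ≠ 0)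
    (h1 : a + t * b = c + t * d) (h2 : a - t * b = c - t * d) : a = c ∧ b = d :=
  ⟨by linear_combination (h1 + h2) / 2,
    mul_left_cancel₀ ht (by linear_combination (h1 - h2) / 2)⟩

theorem summable_pow_div_qPoch_comp {q : ℂ} (hq : ‖q‖ < 1) (g : ℕ → ℕ) :
    Summable fun c => q ^ c / qPoch q q (g c) := by
  obtain ⟨D, hD, h'⟩ := exists_norm_inv_qPoch_le hq hq
  refine Summable.of_norm_bounded ((summable_geometric_of_lt_one (norm_nonneg q) hq).mul_left D)
    fun n => ?_
  rw [div_eq_mul_inv, norm_mul, norm_pow, mul_comm]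
  gcongr
  exact h' _

theorem inv_qPochInf_eq_even_add_odd {x : ℂ} (hx : ‖x‖ < 1) :
    (qPochInf x (x ^ 2))⁻¹ = ∑' c, (x ^ 2) ^ c / qPoch (x ^ 2) (x ^ 2) (2 * c) +
      x * ∑' c, (x ^ 2) ^ c / qPoch (x ^ 2) (x ^ 2) (2 * c + 1) := by
  have hq := norm_pow_lt_one hx two_ne_zero
  have hs := summable_pow_div_qPoch hq hx
  have he := hs.comp_injective (i := fun c => 2 * c) fun _ _ h => by simpa using h
  have ho := hs.comp_injective (i := fun c => 2 * c + 1) fun _ _ h => by simpa using h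
  rw [← tsum_pow_div_qPoch hq hx, ← tsum_mul_left,
    ← tsum_even_add_odd (f := fun n => x ^ n / qPoch (x ^ 2) (x ^ 2) n) he ho]
  congr 1
  · exact tsum_congr fun c => by rw [pow_mul]
  · exact tsum_congr fun c => by rw [pow_succ, pow_mul]; ring

theorem inv_qPochInf_eq_theta {x : ℂ} (hx : ‖x‖ < 1) (hx₀ : x ≠ 0) :
    (qPochInf x (x ^ 2))⁻¹ = (qPochInf (x ^ 2) (x ^ 2))⁻¹ * qPochInf (x ^ 16) (x ^ 16) *
      (qPochInf (-x ^ 6) (x ^ 16) * qPochInf (-x ^ 10) (x ^ 16) +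
        x * (qPochInf (-x ^ 2) (x ^ 16) * qPochInf (-x ^ 14) (x ^ 16))) := by
  have h2 := norm_pow_lt_one hx two_ne_zero
  have h8 := norm_pow_lt_one hx (show 8 ≠ 0 by norm_num)
  have hx2 := pow_ne_zero 2 hx₀
  have hx8 := pow_ne_zero 8 hx₀
  -- `J` sums `x^(2k^2 - k)`; its even and odd `k` give `x^(8k^2 - 2k)` and `x * x^(8k^2 + 6k)`,
  -- summed by `Je` and `Jo`.
  have J := tsum_jacobi h2 hx2 (inv_ne_zero hx₀)
  have Je := tsum_jacobi h8 hx8 (inv_ne_zero hx2)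
  have Jo := tsum_jacobi h8 hx8 (pow_ne_zero 6 hx₀)
  have hsplit := tsum_eq_add_of_isCompl_range
    (fun _ _ h => by simpa using h) (fun _ _ h => by simpa using h) isCompl_range_int_two_mul
    (summable_zpow_mul_zpow_sq h2 hx2 (inv_ne_zero hx₀))
  have he : ∀ k : ℤ, x⁻¹ ^ (2 * k) * (x ^ 2) ^ ((2 * k) ^ 2) =
      (x ^ 2)⁻¹ ^ k * (x ^ 8) ^ (k ^ 2) := by
    intro k
    simp only [← zpow_natCast, ← zpow_neg_one, ← zpow_mul, ← zpow_add₀ hx₀]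
    congr 1
    push_cast
    ring
  have ho : ∀ k : ℤ, x⁻¹ ^ (2 * k + 1) * (x ^ 2) ^ ((2 * k + 1) ^ 2) =
      x * ((x ^ 6) ^ k * (x ^ 8) ^ (k ^ 2)) := by
    intro k
    rw [← zpow_one x]
    simp only [← zpow_natCast, ← zpow_neg_one, ← zpow_mul, ← zpow_add₀ hx₀]
    congr 1
    push_cast
    ring
  simp only [he, ho, tsum_mul_left, Je, Jo] at hsplit
  rw [hsplit] at J
  simp only [← pow_mul, ← pow_add, div_inv_eq_mul] at J
  rw [show x⁻¹ * x ^ 2 = x by field_simp, show x ^ 2 * x = x ^ 3 by ring,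
    show (x ^ 2)⁻¹ * x ^ 8 = x ^ 6 by field_simp, show x ^ 8 / x ^ 6 = x ^ 2 by field_simp] at J
  norm_num only at J
  have d1 : qPochInf (-x) (x ^ 2) = qPochInf (-x) (x ^ 4) * qPochInf (-x ^ 3) (x ^ 4) := by
    rw [qPochInf_eq_mul_sq h2, ← pow_mul, show -x * x ^ 2 = -x ^ 3 by ring]
  have d2 : qPochInf x (x ^ 2) * qPochInf (-x) (x ^ 2) = qPochInf (x ^ 2) (x ^ 4) := by
    rw [qPochInf_mul_neg h2, ← pow_mul]
  have d3 := qPochInf_pow_eq_mul hx 2 two_ne_zero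
  norm_num only at d3
  have n1 := qPochInf_ne_zero h2 hx
  have n2 := qPochInf_ne_zero h2 h2
  field_simp
  rw [d3, ← d2, d1]
  linear_combination (-qPochInf x (x ^ 2)) * J

theorem even_and_odd_series {x : ℂ} (hx : ‖x‖ < 1) (hx₀ : x ≠ 0) :
    ∑' c, (x ^ 2) ^ c / qPoch (x ^ 2) (x ^ 2) (2 * c) =
        (qPochInf (x ^ 2) (x ^ 2))⁻¹ * qPochInf (x ^ 16) (x ^ 16) *
          (qPochInf (-x ^ 6) (x ^ 16) * qPochInf (-x ^ 10) (x ^ 16)) ∧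
      ∑' c, (x ^ 2) ^ c / qPoch (x ^ 2) (x ^ 2) (2 * c + 1) =
        (qPochInf (x ^ 2) (x ^ 2))⁻¹ * qPochInf (x ^ 16) (x ^ 16) *
          (qPochInf (-x ^ 2) (x ^ 16) * qPochInf (-x ^ 14) (x ^ 16)) := by
  have hx' : ‖-x‖ < 1 := by rwa [norm_neg]
  have p1 := (inv_qPochInf_eq_even_add_odd hx).symm.trans (inv_qPochInf_eq_theta hx hx₀)
  have p2 := (inv_qPochInf_eq_even_add_odd hx').symm.trans
    (inv_qPochInf_eq_theta hx' (neg_ne_zero.mpr hx₀))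
  have ev : ∀ n, (-x) ^ (2 * n) = x ^ (2 * n) := fun n => by rw [pow_mul, neg_sq, ← pow_mul]
  rw [neg_sq, ev 3, ev 5, ev 7, ev 8] at p2
  refine eq_and_eq_of_add_mul_of_sub_mul hx₀ ?_ ?_
  · linear_combination p1
  · linear_combination p2

/-! ### Product rearrangements modulo 12 and 48. -/

theorem qPochInf_pow_eq_mul_four {q : ℂ} (hq : ‖q‖ < 1) (i : ℕ) {m : ℕ} (hm : m ≠ 0) :
    qPochInf (q ^ i) (q ^ m) =
      qPochInf (q ^ i) (q ^ (4 * m)) * qPochInf (q ^ (i + m)) (q ^ (4 * m)) *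
        qPochInf (q ^ (i + 2 * m)) (q ^ (4 * m)) * qPochInf (q ^ (i + 3 * m)) (q ^ (4 * m)) := by
  have h2 : 2 * m ≠ 0 := by positivity
  rw [qPochInf_pow_eq_mul hq i hm, qPochInf_pow_eq_mul hq i h2, qPochInf_pow_eq_mul hq (i + m) h2,
    show 2 * (2 * m) = 4 * m by ring, show i + m + 2 * m = i + 3 * m by ring]
  ring

theorem qPochInfList_mul_qPochInfList_neg {q : ℂ} (hq : ‖q‖ < 1) :
    qPochInfList [-q ^ 2, -q ^ 4] (q ^ 6) * qPochInfList [q ^ 2, q ^ 10] (q ^ 12) = 1 := by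
  have a1 := qPochInf_pow_mul_neg hq 2 (show 6 ≠ 0 by norm_num)
  have a2 := qPochInf_pow_mul_neg hq 4 (show 6 ≠ 0 by norm_num)
  have a3 := qPochInf_pow_eq_mul hq 2 (show 6 ≠ 0 by norm_num)
  have a4 := qPochInf_pow_eq_mul hq 4 (show 6 ≠ 0 by norm_num)
  norm_num only at a1 a2 a3 a4
  rw [a3] at a1
  rw [a4] at a2
  have n1 := qPochInf_pow_ne_zero hq (show 4 ≠ 0 by norm_num) (show 12 ≠ 0 by norm_num)
  have n2 := qPochInf_pow_ne_zero hq (show 8 ≠ 0 by norm_num) (show 12 ≠ 0 by norm_num)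
  simp only [qPochInfList, List.map_cons, List.map_nil, List.prod_cons, List.prod_nil, mul_one]
  refine mul_left_cancel₀ (mul_ne_zero n1 n2) ?_
  linear_combination (qPochInf (-q ^ 4) (q ^ 6) * qPochInf (q ^ 4) (q ^ 12) *
    qPochInf (q ^ 10) (q ^ 12)) * a1 + qPochInf (q ^ 4) (q ^ 12) * a2

theorem qPochInf_cube_sixteen {q : ℂ} (hq : ‖q‖ < 1) :
    qPochInf (q ^ 3) (q ^ 3) =
      qPochInfList [q ^ 3, q ^ 6, q ^ 9, q ^ 12, q ^ 15, q ^ 18, q ^ 21, q ^ 24, q ^ 27, q ^ 30,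
        q ^ 33, q ^ 36, q ^ 39, q ^ 42, q ^ 45, q ^ 48] (q ^ 48) := by
  have h12 : 12 ≠ 0 := by norm_num
  have a := qPochInf_pow_eq_mul_four hq 3 three_ne_zero
  have b1 := qPochInf_pow_eq_mul_four hq 3 h12
  have b2 := qPochInf_pow_eq_mul_four hq 6 h12
  have b3 := qPochInf_pow_eq_mul_four hq 9 h12
  have b4 := qPochInf_pow_eq_mul_four hq 12 h12
  norm_num only at a b1 b2 b3 b4
  rw [a, b1, b2, b3, b4]
  simp only [qPochInfList, List.map_cons, List.map_nil, List.prod_cons, List.prod_nil, mul_one]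
  ring

/-- The list lacks the residues 18, 24, 30, 48 and repeats 9, 15, 33, 39. The theta factors turn one
copy of 9, 33 into 18 and one copy of 15, 39 into 30, and `(q^24; q^24)_∞` supplies 24 and 48. -/
theorem theta_mul_even_product {q : ℂ} (hq : ‖q‖ < 1) :
    qPochInf (q ^ 24) (q ^ 24) * (qPochInf (-q ^ 9) (q ^ 24) * qPochInf (-q ^ 15) (q ^ 24)) *
        qPochInfList [q ^ 3, q ^ 6, q ^ 9, q ^ 9, q ^ 12, q ^ 15, q ^ 15, q ^ 21,
          q ^ 27, q ^ 33, q ^ 33, q ^ 36, q ^ 39, q ^ 39, q ^ 42, q ^ 45] (q ^ 48) =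
      qPochInf (q ^ 3) (q ^ 3) := by
  have h24 : 24 ≠ 0 := by norm_num
  have a1 := qPochInf_pow_mul_neg hq 9 h24
  have a2 := qPochInf_pow_mul_neg hq 15 h24
  have a3 := qPochInf_pow_eq_mul hq 9 h24
  have a4 := qPochInf_pow_eq_mul hq 15 h24
  have a5 := qPochInf_pow_eq_mul hq 24 h24
  norm_num only at a1 a2 a3 a4 a5
  rw [a3] at a1
  rw [a4] at a2
  rw [qPochInf_cube_sixteen hq, a5]
  simp only [qPochInfList, List.map_cons, List.map_nil, List.prod_cons, List.prod_nil, mul_one]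
  rw [← a1, ← a2]
  ring

/-- Likewise 3, 27 become 6 and 21, 45 become 42. -/
theorem theta_mul_odd_product {q : ℂ} (hq : ‖q‖ < 1) :
    qPochInf (q ^ 24) (q ^ 24) * (qPochInf (-q ^ 3) (q ^ 24) * qPochInf (-q ^ 21) (q ^ 24)) *
        qPochInfList [q ^ 3, q ^ 3, q ^ 9, q ^ 12, q ^ 15, q ^ 18, q ^ 21, q ^ 21,
          q ^ 27, q ^ 27, q ^ 30, q ^ 33, q ^ 36, q ^ 39, q ^ 45, q ^ 45] (q ^ 48) =
      qPochInf (q ^ 3) (q ^ 3) := by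
  have h24 : 24 ≠ 0 := by norm_num
  have a1 := qPochInf_pow_mul_neg hq 3 h24
  have a2 := qPochInf_pow_mul_neg hq 21 h24
  have a3 := qPochInf_pow_eq_mul hq 3 h24
  have a4 := qPochInf_pow_eq_mul hq 21 h24
  have a5 := qPochInf_pow_eq_mul hq 24 h24
  norm_num only at a1 a2 a3 a4 a5
  rw [a3] at a1
  rw [a4] at a2
  rw [qPochInf_cube_sixteen hq, a5]
  simp only [qPochInfList, List.map_cons, List.map_nil, List.prod_cons, List.prod_nil, mul_one]
  rw [← a1, ← a2]
  ring

/-! ### Separating the two double series. -/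

theorem cubicTerm_even {y : ℂ} (p : ℕ × ℕ) :
    cubicTerm y (2 * p.1, p.2) =
      (y ^ 2) ^ (2 * ((p.1 : ℤ) ^ 2 - 3 * (p.1 : ℤ) * (p.2 : ℤ) + 3 * (p.2 : ℤ) ^ 2))
        / qPoch ((y ^ 2) ^ 3) ((y ^ 2) ^ 3) (2 * p.2) * qBinom (3 * p.2) (2 * p.1) (y ^ 2) := by
  rw [cubicTerm, ← pow_mul, ← zpow_natCast y 2, ← zpow_mul]
  congr 3
  push_cast
  ring

theorem cubicTerm_odd {y : ℂ} (hy₀ : y ≠ 0) (p : ℕ × ℕ) :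
    cubicTerm y (2 * p.1 + 1, p.2) = y ^ 3 *
      ((y ^ 2) ^ (2 * ((p.1 : ℤ) ^ 2 - 3 * (p.1 : ℤ) * (p.2 : ℤ) + 3 * (p.2 : ℤ) ^ 2)
          + 2 * (p.1 : ℤ) - 3 * (p.2 : ℤ) - 1)
        / qPoch ((y ^ 2) ^ 3) ((y ^ 2) ^ 3) (2 * p.2) *
          qBinom (3 * p.2) (2 * p.1 + 1) (y ^ 2)) := by
  rw [cubicTerm, ← mul_assoc, ← mul_div_assoc, ← pow_mul, ← zpow_natCast y 2, ← zpow_mul,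
    ← zpow_natCast y 3, ← zpow_add₀ hy₀]
  congr 3
  push_cast
  ring

theorem cubicTerm_neg_even {y : ℂ} (p : ℕ × ℕ) :
    cubicTerm (-y) (2 * p.1, p.2) = cubicTerm y (2 * p.1, p.2) := by
  rw [cubicTerm_even, cubicTerm_even, neg_sq]

theorem cubicTerm_neg_odd {y : ℂ} (hy₀ : y ≠ 0) (p : ℕ × ℕ) :
    cubicTerm (-y) (2 * p.1 + 1, p.2) = -cubicTerm y (2 * p.1 + 1, p.2) := by
  rw [cubicTerm_odd hy₀, cubicTerm_odd (neg_ne_zero.mpr hy₀), neg_sq]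
  ring

theorem tsum_cubicTerm_even_odd {y : ℂ} (hy : ‖y‖ < 1) (hy₀ : y ≠ 0) :
    ∑' p : ℕ × ℕ, cubicTerm y (2 * p.1, p.2) =
        qPochInfList [-(y ^ 2) ^ 2, -(y ^ 2) ^ 4] ((y ^ 2) ^ 6) *
          ∑' c : ℕ, (y ^ 6) ^ c / qPoch (y ^ 6) (y ^ 6) (2 * c) ∧
      ∑' p : ℕ × ℕ, cubicTerm y (2 * p.1 + 1, p.2) =
        y ^ 3 * (qPochInfList [-(y ^ 2) ^ 2, -(y ^ 2) ^ 4] ((y ^ 2) ^ 6) *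
          ∑' c : ℕ, (y ^ 6) ^ c / qPoch (y ^ 6) (y ^ 6) (2 * c + 1)) := by
  have key : ∀ w : ℂ, ‖w‖ < 1 → w ≠ 0 →
      ∑' p : ℕ × ℕ, cubicTerm w (2 * p.1, p.2) + ∑' p : ℕ × ℕ, cubicTerm w (2 * p.1 + 1, p.2) =
        qPochInfList [-(w ^ 2) ^ 2, -(w ^ 2) ^ 4] ((w ^ 2) ^ 6) *
          (∑' c : ℕ, (w ^ 6) ^ c / qPoch (w ^ 6) (w ^ 6) (2 * c) +
            w ^ 3 * ∑' c : ℕ, (w ^ 6) ^ c / qPoch (w ^ 6) (w ^ 6) (2 * c + 1)) := by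
    intro w hw hw₀
    have h1 := tsum_eq_add_of_isCompl_range
      (fun _ _ h => by simpa [Prod.ext_iff] using h) (fun _ _ h => by simpa [Prod.ext_iff] using h)
      isCompl_range_nat_prod_two_mul (summable_cubicTerm hw hw₀)
    have h2 := inv_qPochInf_eq_even_add_odd (norm_pow_lt_one hw three_ne_zero)
    simp only [← pow_mul w] at h2
    norm_num only at h2
    rw [← h1, tsum_cubicTerm hw hw₀, h2]
    simp only [qPochInfList, List.map_cons, List.map_nil, List.prod_cons, List.prod_nil, mul_one,
      ← pow_mul w]
  have k1 := key y hy hy₀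
  have k2 := key (-y) (by rwa [norm_neg]) (neg_ne_zero.mpr hy₀)
  simp only [cubicTerm_neg_even, cubicTerm_neg_odd hy₀, tsum_neg, neg_sq,
    Even.neg_pow (show Even 6 by decide)] at k2
  -- The factor `y ^ 3` is already inside the odd parts, hence the multiplier 1.
  refine eq_and_eq_of_add_mul_of_sub_mul one_ne_zero ?_ ?_
  · linear_combination k1
  · linear_combination k2

theorem mul_inv_mul_mul_eq_one {S C D J L : ℂ} (hS : S ≠ 0) (h1 : C * D = 1) (h2 : J * L = S) :
    C * (S⁻¹ * J) * (D * L) = 1 := by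
  linear_combination S⁻¹ * J * L * h1 + S⁻¹ * h2 + mul_inv_cancel₀ hS

/-! ### The case `q = 0`. -/

theorem qPoch_zero_zero (n : ℕ) : qPoch 0 0 n = 1 := by simp [qPoch]

theorem qPochInf_zero_zero : qPochInf 0 0 = 1 := by simp [qPochInf]

theorem hasSum_even_summand_zero : HasSum (fun p : ℕ × ℕ =>
    (0 : ℂ) ^ (2 * ((p.1 : ℤ) ^ 2 - 3 * (p.1 : ℤ) * (p.2 : ℤ) + 3 * (p.2 : ℤ) ^ 2))
      / qPoch (0 ^ 3) (0 ^ 3) (2 * p.2) * qBinom (3 * p.2) (2 * p.1) 0) 1 := by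
  convert hasSum_single ((0, 0) : ℕ × ℕ) fun p hp => ?_ using 1
  · simp [qPoch_zero_zero, qBinom]
  · rw [zero_zpow, zero_div, zero_mul]
    contrapose! hp
    have h : (2 * (p.1 : ℤ) - 3 * p.2) ^ 2 + 3 * (p.2 : ℤ) ^ 2 = 0 := by linear_combination 2 * hp
    have h2 : (p.2 : ℤ) = 0 := by
      nlinarith [sq_nonneg (2 * (p.1 : ℤ) - 3 * p.2), sq_nonneg (p.2 : ℤ)]
    have h1 : (p.1 : ℤ) = 0 := by
      rw [h2] at hp
      nlinarith
    exact Prod.ext (by exact_mod_cast h1) (by exact_mod_cast h2)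

theorem hasSum_odd_summand_zero : HasSum (fun p : ℕ × ℕ =>
    (0 : ℂ) ^ (2 * ((p.1 : ℤ) ^ 2 - 3 * (p.1 : ℤ) * (p.2 : ℤ) + 3 * (p.2 : ℤ) ^ 2)
        + 2 * (p.1 : ℤ) - 3 * (p.2 : ℤ) - 1)
      / qPoch (0 ^ 3) (0 ^ 3) (2 * p.2) * qBinom (3 * p.2) (2 * p.1 + 1) 0) 1 := by
  convert hasSum_single ((1, 1) : ℕ × ℕ) fun p hp => ?_ using 1
  · simp [qPoch_zero_zero, qBinom]
  · rw [zero_zpow, zero_div, zero_mul]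
    contrapose! hp
    -- Twice the exponent plus 3 is this quadratic form, so a zero exponent forces `(1, 1)`. The
    -- only negative exponent, at `(0, 0)`, contributes 0.
    have h : (2 * (p.1 : ℤ) + 1 - 3 * p.2) ^ 2 + 3 * (p.2 : ℤ) ^ 2 = 3 := by
      linear_combination 2 * hp
    have h2 : p.2 ≤ 1 := by
      by_contra! hlt
      have : (2 : ℤ) ≤ p.2 := by exact_mod_cast hlt
      nlinarith [sq_nonneg (2 * (p.1 : ℤ) + 1 - 3 * p.2)]
    obtain ⟨a, b⟩ := p
    simp only at h h2
    interval_cases b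
    · push_cast at h
      have : a ≤ 0 := by
        by_contra! hlt
        have : (1 : ℤ) ≤ a := by exact_mod_cast hlt
        nlinarith
      interval_cases a
      norm_num at h
    · push_cast at h
      have : (a : ℤ) = 1 := by nlinarith [sq_nonneg ((a : ℤ) - 1)]
      exact Prod.ext (by exact_mod_cast this) rfl

theorem hasSum_pow_div_qPoch_zero (g : ℕ → ℕ) :
    HasSum (fun c => ((0 : ℂ) ^ 3) ^ c / qPoch (0 ^ 3) (0 ^ 3) (g c)) 1 := by
  convert hasSum_single 0 fun c hc => ?_ using 1
  · simp [qPoch_zero_zero]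
  · simp [hc]

/-! ### Assembly. -/

theorem mainTheorem8 (q : ℂ) (hq : ‖q‖ < 1) :
    -- first identity
    (Summable (fun p : ℕ × ℕ =>
        q ^ (2 * ((p.1 : ℤ) ^ 2 - 3 * (p.1 : ℤ) * (p.2 : ℤ) + 3 * (p.2 : ℤ) ^ 2))
          / qPoch (q ^ 3) (q ^ 3) (2 * p.2) * qBinom (3 * p.2) (2 * p.1) q) ∧
      Summable (fun c : ℕ => q ^ (3 * c) / qPoch (q ^ 3) (q ^ 3) (2 * c)) ∧
      (∑' p : ℕ × ℕ,
        q ^ (2 * ((p.1 : ℤ) ^ 2 - 3 * (p.1 : ℤ) * (p.2 : ℤ) + 3 * (p.2 : ℤ) ^ 2))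
          / qPoch (q ^ 3) (q ^ 3) (2 * p.2) * qBinom (3 * p.2) (2 * p.1) q)
        = qPochInfList [-q ^ 2, -q ^ 4] (q ^ 6)
          * ∑' c : ℕ, q ^ (3 * c) / qPoch (q ^ 3) (q ^ 3) (2 * c) ∧
      qPochInfList [-q ^ 2, -q ^ 4] (q ^ 6)
          * ∑' c : ℕ, q ^ (3 * c) / qPoch (q ^ 3) (q ^ 3) (2 * c)
        = 1 / (qPochInfList [q ^ 2, q ^ 10] (q ^ 12)
          * qPochInfList [q ^ 3, q ^ 6, q ^ 9, q ^ 9, q ^ 12, q ^ 15, q ^ 15, q ^ 21,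
              q ^ 27, q ^ 33, q ^ 33, q ^ 36, q ^ 39, q ^ 39, q ^ 42, q ^ 45] (q ^ 48))) ∧
    -- second identity
    (Summable (fun p : ℕ × ℕ =>
        q ^ (2 * ((p.1 : ℤ) ^ 2 - 3 * (p.1 : ℤ) * (p.2 : ℤ) + 3 * (p.2 : ℤ) ^ 2)
              + 2 * (p.1 : ℤ) - 3 * (p.2 : ℤ) - 1)
          / qPoch (q ^ 3) (q ^ 3) (2 * p.2) * qBinom (3 * p.2) (2 * p.1 + 1) q) ∧
      Summable (fun c : ℕ => q ^ (3 * c) / qPoch (q ^ 3) (q ^ 3) (2 * c + 1)) ∧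
      (∑' p : ℕ × ℕ,
        q ^ (2 * ((p.1 : ℤ) ^ 2 - 3 * (p.1 : ℤ) * (p.2 : ℤ) + 3 * (p.2 : ℤ) ^ 2)
              + 2 * (p.1 : ℤ) - 3 * (p.2 : ℤ) - 1)
          / qPoch (q ^ 3) (q ^ 3) (2 * p.2) * qBinom (3 * p.2) (2 * p.1 + 1) q)
        = qPochInfList [-q ^ 2, -q ^ 4] (q ^ 6)
          * ∑' c : ℕ, q ^ (3 * c) / qPoch (q ^ 3) (q ^ 3) (2 * c + 1) ∧
      qPochInfList [-q ^ 2, -q ^ 4] (q ^ 6)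
          * ∑' c : ℕ, q ^ (3 * c) / qPoch (q ^ 3) (q ^ 3) (2 * c + 1)
        = 1 / (qPochInfList [q ^ 2, q ^ 10] (q ^ 12)
          * qPochInfList [q ^ 3, q ^ 3, q ^ 9, q ^ 12, q ^ 15, q ^ 18, q ^ 21, q ^ 21,
              q ^ 27, q ^ 27, q ^ 30, q ^ 33, q ^ 36, q ^ 39, q ^ 45, q ^ 45] (q ^ 48))) := by
  have hq3 := norm_pow_lt_one hq three_ne_zero
  simp only [pow_mul q 3]
  rcases eq_or_ne q 0 with rfl | hq₀
  · have h1 := hasSum_even_summand_zero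
    have h2 := hasSum_odd_summand_zero
    have h3 := hasSum_pow_div_qPoch_zero
    refine ⟨⟨h1.summable, (h3 _).summable, ?_, ?_⟩, h2.summable, (h3 _).summable, ?_, ?_⟩
    · rw [h1.tsum_eq, (h3 _).tsum_eq]
      simp [qPochInfList, qPochInf_zero_zero]
    · rw [(h3 _).tsum_eq]
      simp [qPochInfList, qPochInf_zero_zero]
    · rw [h2.tsum_eq, (h3 _).tsum_eq]
      simp [qPochInfList, qPochInf_zero_zero]
    · rw [(h3 _).tsum_eq]
      simp [qPochInfList, qPochInf_zero_zero]
  obtain ⟨y, rfl⟩ : ∃ y : ℂ, y ^ 2 = q := IsAlgClosed.exists_pow_nat_eq q two_pos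
  have hy₀ : y ≠ 0 := by
    rintro rfl
    simp at hq₀
  have hy : ‖y‖ < 1 := by
    rw [norm_pow] at hq
    exact (sq_lt_one_iff₀ (norm_nonneg y)).mp hq
  have hs := summable_cubicTerm hy hy₀
  have hs1 := hs.comp_injective (i := fun p : ℕ × ℕ => (2 * p.1, p.2))
    fun _ _ h => by simpa [Prod.ext_iff] using h
  have hs2 := hs.comp_injective (i := fun p : ℕ × ℕ => (2 * p.1 + 1, p.2))
    fun _ _ h => by simpa [Prod.ext_iff] using h
  obtain ⟨t1, t2⟩ := tsum_cubicTerm_even_odd hy hy₀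
  obtain ⟨e1, e2⟩ := even_and_odd_series (norm_pow_lt_one hy three_ne_zero)
    (pow_ne_zero 3 hy₀)
  have c1 := qPochInfList_mul_qPochInfList_neg hq
  have c2 := theta_mul_even_product hq
  have c3 := theta_mul_odd_product hq
  have n1 := qPochInf_pow_ne_zero hq three_ne_zero three_ne_zero
  have hpow : ∀ n, (y ^ 3) ^ (2 * n) = (y ^ 2) ^ (3 * n) := fun n => by ring
  have h6 : y ^ 6 = (y ^ 2) ^ 3 := by ring
  rw [hpow 1, hpow 8, hpow 3, hpow 5] at e1
  rw [hpow 1, hpow 8, hpow 7] at e2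
  norm_num only at e1 e2
  simp only [Function.comp_def, cubicTerm_even] at hs1 t1
  simp only [Function.comp_def, cubicTerm_odd hy₀, tsum_mul_left] at hs2 t2
  have hy3 := pow_ne_zero 3 hy₀
  rw [h6] at t1 t2
  refine ⟨⟨hs1, summable_pow_div_qPoch_comp hq3 _, t1, ?_⟩,
    (summable_mul_left_iff hy3).mp hs2, summable_pow_div_qPoch_comp hq3 _,
    mul_left_cancel₀ hy3 t2, ?_⟩
  · rw [e1]
    refine eq_one_div_of_mul_eq_one_left ?_
    rw [mul_assoc (qPochInf _ _)⁻¹]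
    exact mul_inv_mul_mul_eq_one n1 c1 c2
  · rw [e2]
    refine eq_one_div_of_mul_eq_one_left ?_
    rw [mul_assoc (qPochInf _ _)⁻¹]
    exact mul_inv_mul_mul_eq_one n1 c1 c3
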